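/- **Setting.** Let $n\ge 1$ and let $X$ be a real Banach space; $X^n$ carries the norm $\|x\|=(\sum_i\|x_i\|^2)^{1/2}$, and $B(x,r)$ is the closed ball with centre $x$ and radius $r$. The modulus of convexity of a normed space $Z$ is $\delta_Z(t)=\inf\{1-\|\tfrac{z_1+z_2}{2}\| : \|z_1\|,\|z_2\|\le 1,\ \|z_1-z_2\|\ge t\}$. An exchange economy $\mathcal E$ consists of consumption sets $\Omega_i\subseteq X$, utilities $u_i:\Omega_i\to\mathbb R$ ($i=1,\dots,n$), an endowment $\omega\in X$ and a set $\Theta\subseteq X$. Put $c(x)=\sum_i x_i-\omega$ and $u(x)=(u_1(x_1),\dots,u_n(x_n))$. The set of feasible allocations is $\mathcal A=\{x\in\prod_i\Omega_i : c(x)\in\Theta\}$. For $y\in\Theta$ let $N(y,\Theta)=\{p\in X^*:\langle p,\theta-y\rangle\le 0\ \ \forall\theta\in\Theta\}$. A price is a nonzero $p\in X^*$; it induces the endowment distributions $(\omega_i)\in X^n$ with $\langle p,\sum_i\omega_i\rangle=\langle p,\omega\rangle$. An allocation $\bar x\in\mathcal A$ is an *equilibrium* of $\mathcal E$ if there are a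 price $p\in N(c(\bar x),\Theta)$ with $\langle p,\sum_i\bar x_i\rangle=\langle p,\omega\rangle$ and an endowment distribution $(\omega_i)$ induced by $p$ such that, for each $i$, $\langle p,\bar x_i\rangle=\langle p,\omega_i\rangle$ and $\bar x_i$ maximizes $u_i$ over $\{z\in\Omega_i:\langle p,z\rangle\le\langle p,\omega_i\rangle\}$. An allocation $x\in\mathcal A\cap B(x_0,\varepsilon)$ is *Pareto optimal for the $\varepsilon$-localized problem* around $x_0$ if every $y\in\mathcal A\cap B(x_0,\varepsilon)$ with $u_i(y_i)\ge u_i(x_i)$ for all $i$ satisfies $u(y)=u(x)$. **Assumptions.** (A1) $X$ and $X^n$ are uniformly convex, and for each $Z\in\{X,X^n\}$ there is $\kappa>0$ with $\delta_Z(t)\ge\kappa t^2$ for all $t\in[0,2]$. (A2) Each $\Omega_i$ has nonempty interior. (A3) Each $u_i$ is Fréchet differentiable with Lipschitz derivative on $\operatorname{int}\Omega_i$. (A4) $\Theta$ is a nonempty closed convex cone with apex $0$. (A5) For every $x\in\mathcal A$ and every nonzero $p\in N(c(x),\Theta)$ there is an endowment distribution $(\omega_i)$ induced by $p$ such that for all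 $\delta>0$ and all $i$ there is $z\in B(x_i,\delta)$ with $\langle p,z\rangle<\langle p,\omega_i\rangle$. **Theorem.** Let $\mathcal E$ satisfy (A1)–(A4) and let $x_0\in\mathcal A$ be regular, i.e. $x_{0,i}\in\operatorname{int}\Omega_i$ for all $i$ and the derivative of $(u,c)$ at $x_0$ maps $X^n$ onto $\mathbb R^n\times X$. Then there is $\varepsilon_0>0$ with $B(x_{0,i},\varepsilon_0)\subseteq\Omega_i$ for all $i$ such that for every $\varepsilon\in(0,\varepsilon_0]$: 1. there is $x_\varepsilon\in\mathcal A\cap\partial B(x_0,\varepsilon)$ which is Pareto optimal for the $\varepsilon$-localized problem around $x_0$; 2. for every such $x_\varepsilon$, with $\eta_i=\|x_{\varepsilon,i}-x_{0,i}\|$: if (A5) holds, $\min_i\eta_i>0$, and (A6) for all $i$ and $\delta>0$ there is $z\in B(x_{\varepsilon,i},\delta)\cap B(x_{0,i},\eta_i)$ with $u_i(z)>u_i(x_{\varepsilon,i})$, then $x_\varepsilon$ is an equilibrium of the localized economy obtained from $\mathcal E$ by replacing each $\Omega_i$ by $B(x_{0,i},\eta_i)$. -/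

import Mathlib

open Metric

noncomputable section

/-- The modulus of convexity `δ_X(ε)` of a normed space `X`. -/
def modulusOfConvexity (X : Type*) [NormedAddCommGroup X] [NormedSpace ℝ X] (ε : ℝ) : ℝ :=
  sInf {t : ℝ | ∃ x₁ ∈ closedBall (0 : X) 1, ∃ x₂ ∈ closedBall (0 : X) 1,
    ε ≤ ‖x₁ - x₂‖ ∧ t = 1 - ‖(2⁻¹ : ℝ) • (x₁ + x₂)‖}

/-- The modulus of convexity of `X` fulfils the quadratic growth condition. -/
def HasQuadraticModulus (X : Type*) [NormedAddCommGroup X] [NormedSpace ℝ X] : Prop :=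
  ∃ κ : ℝ, 0 < κ ∧ ∀ ε ∈ Set.Icc (0 : ℝ) 2, κ * ε ^ 2 ≤ modulusOfConvexity X ε

/-- The space `Xⁿ` with the `2`-norm `‖x‖ = (∑ i, ‖x i‖²)^(1/2)`. -/
abbrev Bundle (n : ℕ) (X : Type*) [NormedAddCommGroup X] [NormedSpace ℝ X] : Type _ :=
  PiLp 2 (fun _ : Fin n => X)

/-- `f` is of class `C^{1,1}` on the set `U` (used for open `U` only): it is Fréchet
differentiable at each point of `U` and its derivative is Lipschitz continuous on `U`. -/
def IsC11On {X Y : Type*} [NormedAddCommGroup X] [NormedSpace ℝ X]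
    [NormedAddCommGroup Y] [NormedSpace ℝ Y] (f : X → Y) (U : Set X) : Prop :=
  (∀ x ∈ U, DifferentiableAt ℝ f x) ∧
    ∃ L : NNReal, LipschitzOnWith L (fun x => fderiv ℝ f x) U

/-- The normal cone, in the sense of convex analysis, to `S` at a point `y` of `S`. -/
def normalCone {X : Type*} [NormedAddCommGroup X] [NormedSpace ℝ X] (S : Set X) (y : X) :
    Set (X →L[ℝ] ℝ) :=
  {p | ∀ s ∈ S, p (s - y) ≤ 0}

/-- `x` is a (global) `K`-optimal solution of the problem of maximizing `h` over the feasible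
set `R` with respect to the order given by the cone `K`: `h(R) ∩ (h(x) + K) = {h(x)}`. -/
def IsKOptimal {Z W : Type*} [AddCommGroup W] (K : Set W) (h : Z → W) (R : Set Z) (x : Z) :
    Prop :=
  x ∈ R ∧ h '' R ∩ {w | w - h x ∈ K} = {h x}

/-- A pure exchange economy with `n` consumers and commodity space `X`. The value `utility i z`
is meaningful only for `z ∈ consumption i`. -/
structure ExchangeEconomy (n : ℕ) (X : Type*) where
  /-- the consumption sets `Ω_i` -/
  consumption : Fin n → Set X
  /-- the utility functions `u_i` -/
  utility : Fin n → X → ℝ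
  /-- the aggregate initial endowment -/
  endowment : X
  /-- the net demand constraint `Θ` -/
  netDemand : Set X

namespace ExchangeEconomy

variable {n : ℕ} {X : Type*} [NormedAddCommGroup X] [NormedSpace ℝ X]

/-- The mapping `c(x) = ∑ i, x i - ω`. -/
def excess (E : ExchangeEconomy n X) (x : Bundle n X) : X :=
  (∑ i, x i) - E.endowment

/-- The mapping `u(x) = (u_1(x_1), …, u_n(x_n))`. -/
def utilities (E : ExchangeEconomy n X) (x : Bundle n X) : Fin n → ℝ :=
  fun i => E.utility i (x i)

/-- The set of all feasible allocations. -/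
def feasible (E : ExchangeEconomy n X) : Set (Bundle n X) :=
  {x | (∀ i, x i ∈ E.consumption i) ∧ E.excess x ∈ E.netDemand}

/-- `x` is Pareto optimal for the `ε`-localization around `x₀`, in which the feasible set is
intersected with the closed ball with centre `x₀` and radius `ε`. -/
def IsLocalizedPareto (E : ExchangeEconomy n X) (x₀ : Bundle n X) (ε : ℝ) (x : Bundle n X) :
    Prop :=
  IsKOptimal {w : Fin n → ℝ | ∀ i, 0 ≤ w i} E.utilities (E.feasible ∩ closedBall x₀ ε) x

/-- The family `e` is a distribution of the aggregate endowment induced by the price `p`. -/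
def IsDistribution (E : ExchangeEconomy n X) (p : X →L[ℝ] ℝ) (e : Fin n → X) : Prop :=
  p (∑ i, e i) = p E.endowment

/-- `x` is a competitive equilibrium. -/
def IsEquilibrium (E : ExchangeEconomy n X) (x : Bundle n X) : Prop :=
  x ∈ E.feasible ∧ ∃ p : X →L[ℝ] ℝ, p ≠ 0 ∧
    p ∈ normalCone E.netDemand (E.excess x) ∧
    p (∑ i, x i) = p E.endowment ∧
    ∃ e : Fin n → X, E.IsDistribution p e ∧
      ∀ i, p (x i) = p (e i) ∧
        IsMaxOn (E.utility i) {z | z ∈ E.consumption i ∧ p z ≤ p (e i)} (x i)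

/-- The localization of the economy around `x₀` with radii `η i`: the consumption sets become
the closed balls with centres `x₀ i` and radii `η i`. -/
def localize (E : ExchangeEconomy n X) (x₀ : Bundle n X) (η : Fin n → ℝ) :
    ExchangeEconomy n X :=
  { E with consumption := fun i => closedBall (x₀ i) (η i) }

/-- Geometry of the commodity space: `X` and `Xⁿ` are uniformly convex and their moduli of
convexity fulfil the quadratic growth condition. -/
def CommodityGeometry (n : ℕ) (X : Type*) [NormedAddCommGroup X] [NormedSpace ℝ X] : Prop :=
  (UniformConvexSpace X ∧ HasQuadraticModulus X) ∧
    UniformConvexSpace (Bundle n X) ∧ HasQuadraticModulus (Bundle n X)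

/-- Each consumption set has nonempty interior. -/
def ConsumptionInterior (E : ExchangeEconomy n X) : Prop :=
  ∀ i, (interior (E.consumption i)).Nonempty

/-- Each utility function is of class `C^{1,1}` on the interior of the consumption set. -/
def SmoothUtilities (E : ExchangeEconomy n X) : Prop :=
  ∀ i, IsC11On (E.utility i) (interior (E.consumption i))

/-- The net demand constraint is a nonempty closed convex cone with apex at the origin. -/
def NetDemandCone (E : ExchangeEconomy n X) : Prop :=
  E.netDemand.Nonempty ∧ IsClosed E.netDemand ∧ Convex ℝ E.netDemand ∧
    ∀ y ∈ E.netDemand, ∀ t : ℝ, 0 ≤ t → t • y ∈ E.netDemand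

/-- The local qualification condition for the endowment distribution induced by a price system.
Prices are nonzero functionals. -/
def LocalQualification (E : ExchangeEconomy n X) : Prop :=
  ∀ x ∈ E.feasible, ∀ p ∈ normalCone E.netDemand (E.excess x), p ≠ 0 →
    ∃ e : Fin n → X, E.IsDistribution p e ∧
      ∀ ε : ℝ, 0 < ε → ∀ i, ∃ z ∈ closedBall (x i) ε, p z < p (e i)

/-- Every consumer is locally non-satiated at the allocation `x` within her consumption set:
arbitrarily close to `x i`, it contains a commodity that she strictly prefers to `x i`. -/
def LocallyNonSatiatedAt (E : ExchangeEconomy n X) (x : Bundle n X) : Prop :=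
  ∀ i, ∀ δ : ℝ, 0 < δ →
    ∃ z ∈ closedBall (x i) δ ∩ E.consumption i, E.utility i (x i) < E.utility i z

/-- `x₀` is a regular feasible allocation: its components are interior points of the consumption
sets and the Fréchet derivative of `(u, c)` at `x₀` is onto. -/
def IsRegular (E : ExchangeEconomy n X) (x₀ : Bundle n X) : Prop :=
  x₀ ∈ E.feasible ∧ (∀ i, x₀ i ∈ interior (E.consumption i)) ∧
    Function.Surjective (fderiv ℝ (fun x : Bundle n X => (E.utilities x, E.excess x)) x₀)

end ExchangeEconomy

end

/-! Small balls behave convexly under smooth maps, in the spirit of Polyak's principle. Regularity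
yields a redistribution `v` with `∑ i, v i = 0` along which every utility grows at unit rate at
`x₀`. For `x`, `y` in the ball of radius `ε`, the combination with weight `t` misses being concave
in utility by at most `K * t * ‖x - y‖ ^ 2`, but the modulus of `Xⁿ` leaves it a margin of order `t
* ‖x - y‖ ^ 2 / ε`. Spending this margin along `v` outweighs the error once `ε` is small and does
not change the excess (`IsRegular.exists_isImprovableOn`).

Hence the sum of utilities has a quadratic gain at midpoints, so its maximizing sequences converge
without compactness; a maximizer is Pareto optimal, and lies on the sphere because interior points
can be improved along `v`.

The same correction makes the set of attainable utilities and excesses convex. Separation gives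
multipliers `l`, `p` whose Lagrangian is maximal at the optimum over the whole ball. Varying one
component splits it into individual problems: where `l i > 0`, this is utility maximization under
the budget; where `l i = 0`, strict convexity shrinks the budget set to a point. -/

/-! ### Quadratic estimates and existence of maximizers -/

/-- In a space whose modulus of convexity grows quadratically, convex combinations of two points
of a ball lie inside the ball, with a margin that is quadratic in their distance. -/
theorem HasQuadraticModulus.exists_norm_combo_le {Z : Type*} [NormedAddCommGroup Z]
    [NormedSpace ℝ Z] (h : HasQuadraticModulus Z) :
    ∃ κ : ℝ, 0 < κ ∧ ∀ r : ℝ, 0 < r → ∀ a b : Z, ‖a‖ ≤ r → ‖b‖ ≤ r → ∀ t : ℝ, 0 ≤ t → t ≤ 1 / 2 →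
      ‖(1 - t) • a + t • b‖ ≤ r - t * (κ * ‖a - b‖ ^ 2 / r) := by
  obtain ⟨κ, hκ, hmod⟩ := h
  -- The combination also mixes `a` and the midpoint with weights `1 - 2 * t` and `2 * t`, so the
  -- midpoint deficit counts `2 * t` times.
  refine ⟨2 * κ, by positivity, fun r hr a b ha hb t ht0 ht1 => ?_⟩
  have unit_norm : ∀ c : Z, ‖c‖ ≤ r → ‖r⁻¹ • c‖ ≤ 1 := fun c hc => by
    rw [norm_smul, norm_inv, Real.norm_of_nonneg hr.le, inv_mul_le_iff₀ hr]
    linarith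
  have hdist : ‖r⁻¹ • a - r⁻¹ • b‖ = r⁻¹ * ‖a - b‖ := by
    rw [← smul_sub, norm_smul, norm_inv, Real.norm_of_nonneg hr.le]
  have hle2 : ‖r⁻¹ • a - r⁻¹ • b‖ ≤ 2 := by
    linarith [norm_sub_le (r⁻¹ • a) (r⁻¹ • b), unit_norm a ha, unit_norm b hb]
  have hmid : κ * ‖r⁻¹ • a - r⁻¹ • b‖ ^ 2 ≤ 1 - ‖(2⁻¹ : ℝ) • (r⁻¹ • a + r⁻¹ • b)‖ := by
    refine (hmod _ ⟨norm_nonneg _, hle2⟩).trans (csInf_le ⟨0, ?_⟩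
      ⟨_, mem_closedBall_zero_iff.2 (unit_norm a ha), _, mem_closedBall_zero_iff.2 (unit_norm b hb),
        le_rfl, rfl⟩)
    rintro _ ⟨x₁, hx₁, x₂, hx₂, -, rfl⟩
    rw [mem_closedBall_zero_iff] at hx₁ hx₂
    rw [norm_smul, norm_inv, Real.norm_ofNat]
    linarith [norm_add_le x₁ x₂]
  have hmid' : ‖(2⁻¹ : ℝ) • (a + b)‖ ≤ r - κ * ‖a - b‖ ^ 2 / r := by
    have e : (2⁻¹ : ℝ) • (r⁻¹ • a + r⁻¹ • b) = r⁻¹ • ((2⁻¹ : ℝ) • (a + b)) := by module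
    rw [e, hdist, norm_smul, norm_inv, Real.norm_of_nonneg hr.le] at hmid
    have := mul_le_mul_of_nonneg_left hmid hr.le
    have e₁ : r * (κ * (r⁻¹ * ‖a - b‖) ^ 2) = κ * ‖a - b‖ ^ 2 / r := by field_simp
    have e₂ : r * (1 - r⁻¹ * ‖(2⁻¹ : ℝ) • (a + b)‖) = r - ‖(2⁻¹ : ℝ) • (a + b)‖ := by field_simp
    linarith
  calc ‖(1 - t) • a + t • b‖
      = ‖(1 - 2 * t) • a + (2 * t) • ((2⁻¹ : ℝ) • (a + b))‖ := by congr 1; module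
    _ ≤ (1 - 2 * t) * ‖a‖ + 2 * t * ‖(2⁻¹ : ℝ) • (a + b)‖ := by
        refine (norm_add_le _ _).trans_eq ?_
        rw [norm_smul, norm_smul, Real.norm_of_nonneg (by linarith : 0 ≤ 1 - 2 * t),
          Real.norm_of_nonneg (by linarith : 0 ≤ 2 * t)]
    _ ≤ (1 - 2 * t) * r + 2 * t * (r - κ * ‖a - b‖ ^ 2 / r) := by
        gcongr
        linarith
    _ = r - t * (2 * κ * ‖a - b‖ ^ 2 / r) := by ring

/-- A function with `L`-Lipschitz derivative is concave up to a quadratic error. -/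
theorem Convex.combo_sub_le_of_lipschitz_fderiv {X : Type*} [NormedAddCommGroup X]
    [NormedSpace ℝ X] {f : X → ℝ} {s : Set X} {L : ℝ} (hs : Convex ℝ s)
    (hf : ∀ x ∈ s, DifferentiableAt ℝ f x)
    (hL : ∀ x ∈ s, ∀ y ∈ s, ‖fderiv ℝ f x - fderiv ℝ f y‖ ≤ L * ‖x - y‖) (hL0 : 0 ≤ L)
    {x y : X} (hx : x ∈ s) (hy : y ∈ s) {t : ℝ} (ht0 : 0 ≤ t) (ht1 : t ≤ 1) :
    (1 - t) * f x + t * f y - L * t * ‖x - y‖ ^ 2 ≤ f ((1 - t) • x + t • y) := by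
  set m := (1 - t) • x + t • y with hm
  have hms : m ∈ s := hs hx hy (by linarith) ht0 (by ring)
  have key : ∀ z ∈ s, f z ≤ f m + fderiv ℝ f m (z - m) + L * ‖z - m‖ * ‖z - m‖ := fun z hz => by
    have hseg : segment ℝ m z ⊆ s := hs.segment_subset hms hz
    have h := Convex.norm_image_sub_le_of_norm_fderiv_le' (f := f) (C := L * ‖z - m‖)
      (φ := fderiv ℝ f m) (fun w hw => hf w (hseg hw)) (fun w hw => ?_) (convex_segment m z)
      (left_mem_segment ℝ m z) (right_mem_segment ℝ m z)
    · have := (abs_le.1 (Real.norm_eq_abs _ ▸ h)).2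
      linarith
    · refine (hL w (hseg hw) m hms).trans (mul_le_mul_of_nonneg_left ?_ hL0)
      rw [segment_eq_image'] at hw
      obtain ⟨θ, hθ, rfl⟩ := hw
      rw [add_sub_cancel_left, norm_smul, Real.norm_of_nonneg hθ.1]
      exact mul_le_of_le_one_left (norm_nonneg _) hθ.2
  have hxm : x - m = t • (x - y) := by rw [hm]; module
  have hym : y - m = (-(1 - t)) • (x - y) := by rw [hm]; module
  have h₁ := key x hx
  have h₂ := key y hy
  rw [hxm, map_smul, norm_smul, Real.norm_of_nonneg ht0, smul_eq_mul] at h₁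
  rw [hym, map_smul, norm_smul, norm_neg, Real.norm_of_nonneg (by linarith : 0 ≤ 1 - t),
    smul_eq_mul] at h₂
  -- In the weighted average the linear terms cancel, and the errors add up to `L * t * (1 - t) * ‖x
  -- - y‖ ^ 2`.
  have h₃ := add_le_add (mul_le_mul_of_nonneg_left h₁ (by linarith : 0 ≤ 1 - t))
    (mul_le_mul_of_nonneg_left h₂ ht0)
  have h₄ : 0 ≤ L * t ^ 2 * ‖x - y‖ ^ 2 := by positivity
  nlinarith [h₃, h₄]

/-- A function that at some point of the set exceeds its midpoint average by a quadratic term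
attains its maximum: maximizing sequences are Cauchy. -/
theorem exists_isMaxOn_of_quadratic_gain {Z : Type*} [MetricSpace Z] [CompleteSpace Z] {R : Set Z}
    {S : Z → ℝ} {μ : ℝ} (hμ : 0 < μ) (hR : IsClosed R) (hne : R.Nonempty) (hb : BddAbove (S '' R))
    (hc : ContinuousOn S R)
    (hgain : ∀ x ∈ R, ∀ y ∈ R, ∃ z ∈ R, (S x + S y) / 2 + μ * dist x y ^ 2 ≤ S z) :
    ∃ x ∈ R, IsMaxOn S R x := by
  obtain ⟨w, hw_mono, hw_lim, hw_mem⟩ := exists_seq_tendsto_sSup (hne.image S) hb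
  choose x hxR hxw using hw_mem
  have hle : ∀ y ∈ R, S y ≤ sSup (S '' R) := fun y hy => le_csSup hb ⟨y, hy, rfl⟩
  have hcau : CauchySeq x := by
    refine cauchySeq_of_le_tendsto_0 (fun N => √((sSup (S '' R) - w N) / μ)) ?_ ?_
    · intro k m N hk hm
      obtain ⟨z, hz, h⟩ := hgain _ (hxR k) _ (hxR m)
      refine Real.le_sqrt_of_sq_le ?_
      rw [le_div_iff₀ hμ]
      linarith [hle z hz, hw_mono hk, hw_mono hm, hxw k, hxw m]
    · have : Filter.Tendsto (fun N => √((sSup (S '' R) - w N) / μ)) Filter.atTop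
          (nhds √((sSup (S '' R) - sSup (S '' R)) / μ)) :=
        ((tendsto_const_nhds.sub hw_lim).div_const μ).sqrt
      simpa using this
  obtain ⟨y, hy⟩ := cauchySeq_tendsto_of_complete hcau
  have hyR : y ∈ R := hR.mem_of_tendsto hy (Filter.Eventually.of_forall hxR)
  have hlim : Filter.Tendsto (fun k => S (x k)) Filter.atTop (nhds (S y)) :=
    (hc y hyR).tendsto.comp (tendsto_nhdsWithin_iff.2 ⟨hy, Filter.Eventually.of_forall hxR⟩)
  have hSy : S y = sSup (S '' R) := by
    refine tendsto_nhds_unique hlim ?_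
    simpa only [hxw] using hw_lim
  exact ⟨y, hyR, fun z hz => (hle z hz).trans_eq hSy.symm⟩

namespace ExchangeEconomy

variable {n : ℕ} {X : Type*} [NormedAddCommGroup X] [NormedSpace ℝ X]

/-! ### Improvable balls around a regular allocation -/

/-- On the ball with centre `x₀` and radius `ε`, the utilities are well behaved, the redistribution
`v` of commodities raises all of them at a uniform rate, and convex combinations of allocations
can be corrected along `v` so that the utilities are concave with a quadratic gain. -/
structure IsImprovableOn (E : ExchangeEconomy n X) (x₀ v : Bundle n X) (ε : ℝ) : Prop where
  subset : ∀ i, closedBall (x₀ i) ε ⊆ E.consumption i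
  continuousOn : ∀ i, ContinuousOn (E.utility i) (closedBall (x₀ i) ε)
  bddAbove : ∀ i, BddAbove (E.utility i '' closedBall (x₀ i) ε)
  sum_eq_zero : ∑ i, v i = 0
  add_le : ∀ i, ∀ z ∈ closedBall (x₀ i) ε, ∀ s : ℝ, 0 ≤ s → z + s • v i ∈ closedBall (x₀ i) ε →
    E.utility i z + s / 2 ≤ E.utility i (z + s • v i)
  exists_combo : ∀ x ∈ closedBall x₀ ε, ∀ y ∈ closedBall x₀ ε, ∀ t : ℝ, 0 ≤ t → t ≤ 1 / 2 →
    ∃ z ∈ closedBall x₀ ε, E.excess z = (1 - t) • E.excess x + t • E.excess y ∧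
      ∀ i, (1 - t) * E.utility i (x i) + t * E.utility i (y i) + t * ‖x - y‖ ^ 2 ≤
        E.utility i (z i)

theorem apply_mem_closedBall {x₀ x : Bundle n X} {ε : ℝ} (hx : x ∈ closedBall x₀ ε) (i : Fin n) :
    x i ∈ closedBall (x₀ i) ε := by
  rw [mem_closedBall_iff_norm] at hx ⊢
  exact (PiLp.norm_apply_le (x - x₀) i).trans hx

theorem excess_combo (E : ExchangeEconomy n X) (x y : Bundle n X) (t : ℝ) :
    E.excess ((1 - t) • x + t • y) = (1 - t) • E.excess x + t • E.excess y := by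
  simp only [excess, PiLp.add_apply, PiLp.smul_apply, Finset.sum_add_distrib, ← Finset.smul_sum]
  module

theorem excess_add_smul (E : ExchangeEconomy n X) (x : Bundle n X) {v : Bundle n X}
    (hv : ∑ i, v i = 0) (s : ℝ) : E.excess (x + s • v) = E.excess x := by
  simp only [excess, PiLp.add_apply, PiLp.smul_apply, Finset.sum_add_distrib, ← Finset.smul_sum,
    hv, smul_zero, add_zero]

/-- Regularity provides a redistribution that raises every utility at unit rate. -/
theorem IsRegular.exists_redistribution {E : ExchangeEconomy n X} {x₀ : Bundle n X}
    (h : E.IsRegular x₀) (hd : ∀ i, DifferentiableAt ℝ (E.utility i) (x₀ i)) :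
    ∃ v : Bundle n X, ∑ i, v i = 0 ∧ ∀ i, fderiv ℝ (E.utility i) (x₀ i) (v i) = 1 := by
  obtain ⟨v, hv⟩ := h.2.2 (fun _ => 1, 0)
  have hproj : ∀ i, HasFDerivAt (fun x : Bundle n X => x i)
      (PiLp.proj (𝕜 := ℝ) 2 (fun _ : Fin n => X) i) x₀ := fun i => PiLp.hasFDerivAt_apply 2 x₀ i
  have hu : HasFDerivAt (fun x : Bundle n X => E.utilities x)
      (ContinuousLinearMap.pi fun i => (fderiv ℝ (E.utility i) (x₀ i)).comp
        (PiLp.proj (𝕜 := ℝ) 2 (fun _ : Fin n => X) i)) x₀ :=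
    hasFDerivAt_pi.2 fun i => (hd i).hasFDerivAt.comp x₀ (hproj i)
  have hc : HasFDerivAt (fun x : Bundle n X => E.excess x)
      (∑ i, PiLp.proj (𝕜 := ℝ) 2 (fun _ : Fin n => X) i) x₀ :=
    (HasFDerivAt.fun_sum fun i _ => hproj i).sub_const _
  rw [(hu.prodMk hc).fderiv] at hv
  refine ⟨v, ?_, fun i => ?_⟩
  · simpa using congrArg Prod.snd hv
  · simpa using congrFun (congrArg Prod.fst hv) i

/-- Around a regular allocation, all sufficiently small balls are improvable. -/
theorem IsRegular.exists_isImprovableOn {E : ExchangeEconomy n X} {x₀ : Bundle n X}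
    (h : E.IsRegular x₀) (hmod : HasQuadraticModulus (Bundle n X)) (hu : E.SmoothUtilities) :
    ∃ v : Bundle n X, ∃ ε₀ : ℝ, 0 < ε₀ ∧
      ∀ ε : ℝ, 0 < ε → ε ≤ ε₀ → E.IsImprovableOn x₀ v ε := by
  obtain ⟨v, hv0, hv1⟩ := h.exists_redistribution fun i => (hu i).1 _ (h.2.1 i)
  obtain ⟨κ, hκ, hcombo⟩ := hmod.exists_norm_combo_le
  choose L hL using fun i => (hu i).2
  have hball : ∀ i, ∃ r : ℝ, 0 < r ∧ closedBall (x₀ i) r ⊆ interior (E.consumption i) := fun i =>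
    nhds_basis_closedBall.mem_iff.1 (isOpen_interior.mem_nhds (h.2.1 i))
  choose r hr hrs using hball
  obtain ⟨r₀, hr₀, hr₀r⟩ : ∃ r₀ : ℝ, 0 < r₀ ∧ ∀ i, r₀ ≤ r i := by
    have : ∀ᶠ ρ in nhdsWithin (0 : ℝ) (Set.Ioi 0), ∀ i, ρ ≤ r i :=
      Filter.eventually_all.2 fun i => nhdsWithin_le_nhds (eventually_le_nhds (hr i))
    obtain ⟨ρ, h₁, h₂⟩ := (this.and self_mem_nhdsWithin).exists
    exact ⟨ρ, h₂, h₁⟩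
  set K : ℝ := ∑ i, (L i : ℝ) with hK
  have hK0 : 0 ≤ K := Finset.sum_nonneg fun i _ => (L i).2
  have hLK : ∀ i, (L i : ℝ) ≤ K := fun i =>
    Finset.single_le_sum (f := fun i => (L i : ℝ)) (fun i _ => (L i).2) (Finset.mem_univ i)
  set M : ℝ := ‖v‖ + 1 with hM
  have hM0 : 0 < M := by positivity
  -- The first bound keeps the balls in the interiors; the second gives `K * ε * M ≤ 1 / 2`, so
  -- growth along `v` keeps rate `1 / 2`; the third makes the gain `s / 2` at least `(K + 1) * (t *
  -- ‖x - y‖ ^ 2)`: `K` pays for the lack of concavity, `1` remains.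
  refine ⟨v, min r₀ (min (1 / (2 * (K + 1) * M)) (κ / (2 * M * (K + 1)))), by positivity,
    fun ε hε hεle => ?_⟩
  have hε₁ : ε ≤ r₀ := hεle.trans (min_le_left _ _)
  have hε₂ : ε * (2 * (K + 1) * M) ≤ 1 :=
    (le_div_iff₀ (by positivity)).1 (hεle.trans ((min_le_right _ _).trans (min_le_left _ _)))
  have hε₃ : ε * (2 * M * (K + 1)) ≤ κ :=
    (le_div_iff₀ (by positivity)).1 (hεle.trans ((min_le_right _ _).trans (min_le_right _ _)))
  have hsub : ∀ i, closedBall (x₀ i) ε ⊆ interior (E.consumption i) := fun i =>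
    (closedBall_subset_closedBall (hε₁.trans (hr₀r i))).trans (hrs i)
  have hdiff : ∀ i, ∀ z ∈ closedBall (x₀ i) ε, DifferentiableAt ℝ (E.utility i) z :=
    fun i z hz => (hu i).1 z (hsub i hz)
  have hlip : ∀ i, ∀ z ∈ closedBall (x₀ i) ε, ∀ w ∈ closedBall (x₀ i) ε,
      ‖fderiv ℝ (E.utility i) z - fderiv ℝ (E.utility i) w‖ ≤ K * ‖z - w‖ := fun i z hz w hw =>
    ((hL i).norm_sub_le (hsub i hz) (hsub i hw)).trans
      (mul_le_mul_of_nonneg_right (hLK i) (norm_nonneg _))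
  have hcenter : ∀ i, x₀ i ∈ closedBall (x₀ i) ε := fun i => mem_closedBall_self hε.le
  have htaylor : ∀ i, ∀ z ∈ closedBall (x₀ i) ε, ∀ w ∈ closedBall (x₀ i) ε,
      |E.utility i w - E.utility i z - fderiv ℝ (E.utility i) (x₀ i) (w - z)| ≤
        K * ε * ‖w - z‖ := fun i z hz w hw =>
    Convex.norm_image_sub_le_of_norm_fderiv_le' (hdiff i)
      (fun y hy => (hlip i y hy _ (hcenter i)).trans
        (mul_le_mul_of_nonneg_left (mem_closedBall_iff_norm.1 hy) hK0))
      (convex_closedBall _ _) hz hw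
  have hadd : ∀ i, ∀ z ∈ closedBall (x₀ i) ε, ∀ s : ℝ, 0 ≤ s →
      z + s • v i ∈ closedBall (x₀ i) ε →
      E.utility i z + s / 2 ≤ E.utility i (z + s • v i) := fun i z hz s hs hzs => by
    have h₁ := (abs_le.1 (htaylor i z hz _ hzs)).1
    rw [add_sub_cancel_left, map_smul, hv1, norm_smul, Real.norm_of_nonneg hs, smul_eq_mul] at h₁
    have h₂ : ‖v i‖ ≤ M := (PiLp.norm_apply_le v i).trans (by linarith)
    have h₃ : K * ε * (s * ‖v i‖) ≤ K * ε * (s * M) := by gcongr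
    have h₄ : s * (ε * (2 * (K + 1) * M)) ≤ s * 1 := mul_le_mul_of_nonneg_left hε₂ hs
    have h₅ : 0 ≤ s * ε * M := by positivity
    nlinarith
  refine ⟨fun i => (hsub i).trans interior_subset,
    fun i z hz => (hdiff i z hz).continuousAt.continuousWithinAt, fun i => ?_, hv0, hadd, ?_⟩
  · refine ⟨E.utility i (x₀ i) + (‖fderiv ℝ (E.utility i) (x₀ i)‖ * ε + K * ε * ε), ?_⟩
    rintro _ ⟨z, hz, rfl⟩
    have h₁ := (abs_le.1 (htaylor i _ (hcenter i) z hz)).2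
    have h₂ : ‖z - x₀ i‖ ≤ ε := mem_closedBall_iff_norm.1 hz
    have h₃ := (le_abs_self _).trans ((fderiv ℝ (E.utility i) (x₀ i)).le_opNorm (z - x₀ i))
    have h₄ : ‖fderiv ℝ (E.utility i) (x₀ i)‖ * ‖z - x₀ i‖ ≤
        ‖fderiv ℝ (E.utility i) (x₀ i)‖ * ε := by gcongr
    have h₅ : K * ε * ‖z - x₀ i‖ ≤ K * ε * ε := by gcongr
    linarith
  · intro x hx y hy t ht0 ht1
    set m : Bundle n X := (1 - t) • x + t • y with hm
    -- As `‖v‖ ≤ M`, this step along `v` uses at most the margin left by convexity.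
    set s : ℝ := t * (κ * ‖x - y‖ ^ 2 / ε) / M with hs
    have hs0 : 0 ≤ s := by positivity
    have hm_norm : ‖m - x₀‖ ≤ ε - t * (κ * ‖x - y‖ ^ 2 / ε) := by
      have := hcombo ε hε (x - x₀) (y - x₀) (mem_closedBall_iff_norm.1 hx)
        (mem_closedBall_iff_norm.1 hy) t ht0 ht1
      rw [sub_sub_sub_cancel_right] at this
      have e : (1 - t) • (x - x₀) + t • (y - x₀) = m - x₀ := by rw [hm]; module
      rwa [e] at this
    have hsv : ‖s • v‖ ≤ t * (κ * ‖x - y‖ ^ 2 / ε) := by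
      rw [norm_smul, Real.norm_of_nonneg hs0]
      calc s * ‖v‖ ≤ s * M := by gcongr; linarith
        _ = _ := by rw [hs]; field_simp
    have hm_mem : m ∈ closedBall x₀ ε := mem_closedBall_iff_norm.2
      (hm_norm.trans (sub_le_self _ (by positivity)))
    have hz_mem : m + s • v ∈ closedBall x₀ ε := by
      rw [mem_closedBall_iff_norm, add_sub_right_comm]
      linarith [norm_add_le (m - x₀) (s • v)]
    refine ⟨m + s • v, hz_mem, ?_, fun i => ?_⟩
    · rw [excess_add_smul E m hv0, hm, excess_combo]
    · have h₁ := hadd i (m i) (apply_mem_closedBall hm_mem i) s hs0 (apply_mem_closedBall hz_mem i)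
      have h₂ := Convex.combo_sub_le_of_lipschitz_fderiv (convex_closedBall (x₀ i) ε) (hdiff i)
        (hlip i) hK0 (apply_mem_closedBall hx i) (apply_mem_closedBall hy i) ht0 (by linarith)
      have h₃ : ‖x i - y i‖ ≤ ‖x - y‖ := PiLp.norm_apply_le (x - y) i
      have h₄ : K * t * ‖x i - y i‖ ^ 2 ≤ K * t * ‖x - y‖ ^ 2 := by gcongr
      have h₅ : (K + 1) * (t * ‖x - y‖ ^ 2) ≤ s / 2 := by
        have e : s / 2 = κ / (2 * M * ε) * (t * ‖x - y‖ ^ 2) := by rw [hs]; field_simp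
        rw [e]
        gcongr
        rw [le_div_iff₀ (by positivity)]
        linarith
      simp only [PiLp.add_apply, PiLp.smul_apply, hm] at h₁ ⊢
      linarith

/-! ### Existence of localized Pareto optima -/

/-- Every allocation in the open ball can be improved strictly for all consumers at once. -/
theorem IsImprovableOn.exists_forall_lt {E : ExchangeEconomy n X} {x₀ v x : Bundle n X} {ε : ℝ}
    (h : E.IsImprovableOn x₀ v ε) (hx : x ∈ ball x₀ ε) :
    ∃ y ∈ closedBall x₀ ε, E.excess y = E.excess x ∧ ∀ i, E.utility i (x i) < E.utility i (y i) := by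
  have hcont : ContinuousAt (fun s : ℝ => x + s • v) 0 := by fun_prop
  have hev : ∀ᶠ s in nhdsWithin (0 : ℝ) (Set.Ioi 0), x + s • v ∈ ball x₀ ε :=
    nhdsWithin_le_nhds (hcont.eventually_mem (by simpa using isOpen_ball.mem_nhds hx))
  obtain ⟨s, hs, hs0 : 0 < s⟩ := (hev.and self_mem_nhdsWithin).exists
  have hmem := ball_subset_closedBall hs
  refine ⟨_, hmem, excess_add_smul E x h.sum_eq_zero s, fun i => ?_⟩
  have := h.add_le i (x i) (apply_mem_closedBall (ball_subset_closedBall hx) i) s hs0.le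
    (apply_mem_closedBall hmem i)
  simp only [PiLp.add_apply, PiLp.smul_apply]
  linarith

theorem IsImprovableOn.mem_feasible_inter_iff {E : ExchangeEconomy n X} {x₀ v x : Bundle n X}
    {ε : ℝ} (h : E.IsImprovableOn x₀ v ε) :
    x ∈ E.feasible ∩ closedBall x₀ ε ↔ x ∈ closedBall x₀ ε ∧ E.excess x ∈ E.netDemand :=
  ⟨fun hx => ⟨hx.2, hx.1.2⟩,
    fun hx => ⟨⟨fun i => h.subset i (apply_mem_closedBall hx.1 i), hx.2⟩, hx.1⟩⟩

theorem IsLocalizedPareto.not_forall_lt [NeZero n] {E : ExchangeEconomy n X} {x₀ x : Bundle n X}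
    {ε : ℝ} (hx : E.IsLocalizedPareto x₀ ε x) {y : Bundle n X}
    (hy : y ∈ E.feasible ∩ closedBall x₀ ε) : ¬ ∀ i, E.utility i (x i) < E.utility i (y i) := by
  intro hlt
  have hmem : E.utilities y ∈ ({E.utilities x} : Set (Fin n → ℝ)) := by
    rw [← hx.2]
    exact ⟨⟨y, hy, rfl⟩, fun i => sub_nonneg.2 (hlt i).le⟩
  exact (hlt 0).ne' (congrFun hmem 0)

/-- Existence of a Pareto optimal allocation for the localized problem, on the sphere. -/
theorem IsImprovableOn.exists_isLocalizedPareto [CompleteSpace X] [NeZero n]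
    {E : ExchangeEconomy n X} {x₀ v : Bundle n X} {ε : ℝ} (h : E.IsImprovableOn x₀ v ε)
    (hε : 0 < ε) (hx₀ : x₀ ∈ E.feasible) (hclosed : IsClosed E.netDemand)
    (hconv : Convex ℝ E.netDemand) :
    ∃ x ∈ E.feasible ∩ sphere x₀ ε, E.IsLocalizedPareto x₀ ε x := by
  set R := E.feasible ∩ closedBall x₀ ε with hR
  have hR_eq : R = closedBall x₀ ε ∩ E.excess ⁻¹' E.netDemand :=
    Set.ext fun x => h.mem_feasible_inter_iff
  have hexc : Continuous E.excess := by
    unfold excess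
    fun_prop
  have hR_ball : ∀ x ∈ R, ∀ i, x i ∈ closedBall (x₀ i) ε := fun x hx => apply_mem_closedBall hx.2
  obtain ⟨x, hx, hmax⟩ := exists_isMaxOn_of_quadratic_gain (R := R)
    (S := fun x : Bundle n X => ∑ i, E.utility i (x i)) (μ := 1 / 2) (by norm_num)
    (by rw [hR_eq]; exact isClosed_closedBall.inter (hclosed.preimage hexc))
    ⟨x₀, hx₀, mem_closedBall_self hε.le⟩
    (by
      choose b hb using h.bddAbove
      refine ⟨∑ i, b i, ?_⟩
      rintro _ ⟨x, hx, rfl⟩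
      exact Finset.sum_le_sum fun i _ => hb i ⟨x i, hR_ball x hx i, rfl⟩)
    (continuousOn_finsetSum _ fun i _ =>
      (h.continuousOn i).comp (by fun_prop) fun x hx => hR_ball x hx i)
    (by
      intro x hx y hy
      obtain ⟨z, hz, hzc, hzu⟩ := h.exists_combo x hx.2 y hy.2 (1 / 2) (by norm_num) le_rfl
      refine ⟨z, h.mem_feasible_inter_iff.2 ⟨hz, ?_⟩, ?_⟩
      · rw [hzc]
        exact hconv hx.1.2 hy.1.2 (by norm_num) (by norm_num) (by norm_num)
      · have hsum := Finset.sum_le_sum fun i (_ : i ∈ Finset.univ) => hzu i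
        rw [Finset.sum_add_distrib, Finset.sum_add_distrib, ← Finset.mul_sum, ← Finset.mul_sum,
          Finset.sum_const, Finset.card_univ, Fintype.card_fin, nsmul_eq_mul] at hsum
        -- Each consumer gains `1 / 2 * ‖x - y‖ ^ 2`, so a single one suffices for `μ = 1 / 2`.
        have hn : (1 : ℝ) ≤ n := Nat.one_le_cast.2 (NeZero.one_le)
        have := mul_le_mul_of_nonneg_right hn (by positivity : 0 ≤ 1 / 2 * ‖x - y‖ ^ 2)
        rw [dist_eq_norm]
        linarith)
  have hpareto : E.IsLocalizedPareto x₀ ε x := by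
    refine ⟨hx, Set.eq_singleton_iff_unique_mem.2 ⟨⟨⟨x, hx, rfl⟩, fun i => by simp⟩, ?_⟩⟩
    rintro _ ⟨⟨y, hy, rfl⟩, hle⟩
    have hle' : ∀ i ∈ Finset.univ, E.utility i (x i) ≤ E.utility i (y i) :=
      fun i _ => sub_nonneg.1 (hle i)
    have heq := (Finset.sum_eq_sum_iff_of_le hle').1
      ((Finset.sum_le_sum hle').antisymm (hmax hy))
    exact funext fun i => (heq i (Finset.mem_univ i)).symm
  refine ⟨x, ⟨hx.1, ?_⟩, hpareto⟩
  by_contra hns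
  have hball : x ∈ ball x₀ ε := by
    rw [mem_ball]
    exact lt_of_le_of_ne hx.2 hns
  obtain ⟨y, hy, hyc, hlt⟩ := h.exists_forall_lt hball
  exact hpareto.not_forall_lt (h.mem_feasible_inter_iff.2 ⟨hy, hyc ▸ hx.1.2⟩) hlt

/-! ### Separation and multipliers -/

/-- The pairs `(a, b)` such that some allocation in the ball provides at least the utilities `a`
and has excess in `b + Θ`. -/
def attainable (E : ExchangeEconomy n X) (x₀ : Bundle n X) (ε : ℝ) : Set ((Fin n → ℝ) × X) :=
  {g | ∃ y ∈ closedBall x₀ ε, (∀ i, g.1 i ≤ E.utility i (y i)) ∧ E.excess y - g.2 ∈ E.netDemand}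

theorem IsImprovableOn.convex_attainable {E : ExchangeEconomy n X} {x₀ v : Bundle n X} {ε : ℝ}
    (h : E.IsImprovableOn x₀ v ε) (hconv : Convex ℝ E.netDemand) :
    Convex ℝ (E.attainable x₀ ε) := by
  have key : ∀ g ∈ E.attainable x₀ ε, ∀ g' ∈ E.attainable x₀ ε, ∀ t : ℝ, 0 ≤ t → t ≤ 1 / 2 →
      (1 - t) • g + t • g' ∈ E.attainable x₀ ε := by
    rintro g ⟨y, hy, hgy, hc⟩ g' ⟨y', hy', hgy', hc'⟩ t ht0 ht1
    obtain ⟨z, hz, hzc, hzu⟩ := h.exists_combo y hy y' hy' t ht0 ht1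
    refine ⟨z, hz, fun i => ?_, ?_⟩
    · have h₁ := mul_le_mul_of_nonneg_left (hgy i) (by linarith : 0 ≤ 1 - t)
      have h₂ := mul_le_mul_of_nonneg_left (hgy' i) ht0
      have h₃ : 0 ≤ t * ‖y - y'‖ ^ 2 := by positivity
      have h₄ := hzu i
      simp only [Prod.fst_add, Prod.smul_fst, Pi.add_apply, Pi.smul_apply, smul_eq_mul]
      linarith
    · have := hconv hc hc' (by linarith : 0 ≤ 1 - t) ht0 (by ring)
      convert this using 1
      rw [hzc, Prod.snd_add, Prod.smul_snd, Prod.smul_snd]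
      module
  intro g hg g' hg' a b ha hb hab
  -- Corrected combinations exist only for weights up to `1 / 2`; exchanging the points covers the
  -- rest.
  rcases le_total b (1 / 2) with hb' | hb'
  · obtain rfl : a = 1 - b := by linarith
    exact key g hg g' hg' b hb hb'
  · obtain rfl : b = 1 - a := by linarith
    rw [add_comm]
    exact key g' hg' g hg a ha (by linarith)

/-- Lowering utilities by `1` at `x₀` leaves slack, and consumer `0` absorbs any small change of the
excess. -/
theorem IsImprovableOn.nonempty_interior_attainable [NeZero n] {E : ExchangeEconomy n X}
    {x₀ v : Bundle n X} {ε : ℝ} (h : E.IsImprovableOn x₀ v ε) (hε : 0 < ε)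
    (h0 : (0 : X) ∈ E.netDemand) : (interior (E.attainable x₀ ε)).Nonempty := by
  refine ⟨(fun i => E.utility i (x₀ i) - 1, E.excess x₀), mem_interior_iff_mem_nhds.2 ?_⟩
  set Y : (Fin n → ℝ) × X → Bundle n X := fun g =>
    WithLp.toLp 2 (x₀.ofLp + Pi.single 0 (g.2 - E.excess x₀)) with hY
  set g₀ : (Fin n → ℝ) × X := (fun i => E.utility i (x₀ i) - 1, E.excess x₀) with hg₀
  have hY₀ : Y g₀ = x₀ := by simp [hY, hg₀]
  have hsingle : Continuous fun g : (Fin n → ℝ) × X =>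
      (Pi.single 0 (g.2 - E.excess x₀) : Fin n → X) :=
    (continuous_single (0 : Fin n)).comp (continuous_snd.sub continuous_const)
  have hYc : Continuous Y := (PiLp.continuous_toLp 2 _).comp (continuous_const.add hsingle)
  have hball : ∀ᶠ g in nhds g₀, Y g ∈ closedBall x₀ ε :=
    hYc.continuousAt.eventually_mem (by rw [hY₀]; exact closedBall_mem_nhds _ hε)
  have hutil : ∀ᶠ g in nhds g₀, ∀ i, g.1 i < E.utility i (Y g i) := by
    refine Filter.eventually_all.2 fun i => ?_
    have hu : ContinuousAt (E.utility i) (Y g₀ i) := by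
      rw [hY₀]
      exact (h.continuousOn i).continuousAt (closedBall_mem_nhds _ hε)
    have hYi : ContinuousAt (fun g => Y g i) g₀ := by fun_prop
    refine ContinuousAt.eventually_lt (by fun_prop)
      (ContinuousAt.comp' (f := fun g => Y g i) hu hYi) ?_
    rw [hY₀, hg₀]
    simp
  filter_upwards [hball, hutil] with g hg hgu
  refine ⟨Y g, hg, fun i => (hgu i).le, ?_⟩
  have : E.excess (Y g) - g.2 = 0 := by
    simp only [hY, excess, Pi.add_apply, Finset.sum_add_distrib, Finset.sum_pi_single',
      Finset.mem_univ, if_true]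
    abel
  rwa [this]

/-- Lagrange multipliers at a Pareto optimal allocation of the localized problem. -/
theorem IsImprovableOn.exists_multipliers [NeZero n] {E : ExchangeEconomy n X}
    {x₀ v x : Bundle n X} {ε : ℝ} (h : E.IsImprovableOn x₀ v ε) (hε : 0 < ε)
    (hΘ : E.NetDemandCone) (hx : E.IsLocalizedPareto x₀ ε x) :
    ∃ (l : Fin n → ℝ) (p : X →L[ℝ] ℝ), (l ≠ 0 ∨ p ≠ 0) ∧ (∀ i, 0 ≤ l i) ∧
      p ∈ normalCone E.netDemand (E.excess x) ∧ p (E.excess x) = 0 ∧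
      ∀ y ∈ closedBall x₀ ε, ∑ i, l i * E.utility i (y i) - p (E.excess y) ≤
        ∑ i, l i * E.utility i (x i) - p (E.excess x) := by
  obtain ⟨⟨θ, hθ⟩, -, hconv, hcone⟩ := hΘ
  have h0 : (0 : X) ∈ E.netDemand := by simpa using hcone θ hθ 0 le_rfl
  obtain ⟨hxR, -⟩ := id hx
  set G := E.attainable x₀ ε with hG
  have hGconv : Convex ℝ G := h.convex_attainable hconv
  have hGint : (interior G).Nonempty := h.nonempty_interior_attainable hε h0
  have hnot : (E.utilities x, (0 : X)) ∉ interior G := by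
    intro hmem
    have hcont : Continuous fun s : ℝ => ((fun i => E.utilities x i + s, (0 : X)) :
        (Fin n → ℝ) × X) := by fun_prop
    have hev : ∀ᶠ s in nhdsWithin (0 : ℝ) (Set.Ioi 0),
        ((fun i => E.utilities x i + s, (0 : X)) : (Fin n → ℝ) × X) ∈ interior G :=
      nhdsWithin_le_nhds (hcont.continuousAt.eventually_mem
        (by simpa using isOpen_interior.mem_nhds hmem))
    obtain ⟨s, hs, hs0 : 0 < s⟩ := (hev.and self_mem_nhdsWithin).exists
    obtain ⟨y, hy, hyu, hyc⟩ := interior_subset hs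
    refine hx.not_forall_lt (h.mem_feasible_inter_iff.2 ⟨hy, by simpa using hyc⟩) fun i => ?_
    have := hyu i
    simp only [utilities] at this
    linarith
  obtain ⟨f, hf⟩ := geometric_hahn_banach_open_point hGconv.interior isOpen_interior hnot
  have hfG : ∀ g ∈ G, f g ≤ f (E.utilities x, 0) := fun g hg => by
    have hcl : g ∈ closure (interior G) := by
      rw [hGconv.closure_interior_eq_closure_of_nonempty_interior hGint]
      exact subset_closure hg
    exact closure_minimal (fun a ha => (hf a ha).le)
      (isClosed_le f.continuous continuous_const) hcl
  set l : Fin n → ℝ := fun i => f (Pi.single i 1, 0) with hl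
  -- The sign puts `p` in the normal cone: shrinking `b` by `θ ∈ Θ` stays attainable.
  set p : X →L[ℝ] ℝ := -(f.comp (ContinuousLinearMap.inr ℝ (Fin n → ℝ) X)) with hp
  have hfp : ∀ (a : Fin n → ℝ) (b : X), f (a, b) = ∑ i, l i * a i - p b := fun a b => by
    have ha : ∑ i, a i • ((Pi.single i 1 : Fin n → ℝ), (0 : X)) = (a, 0) := by
      refine Prod.ext ?_ (by simp [Prod.snd_sum])
      ext j
      simp [Prod.fst_sum, Finset.sum_apply, Pi.single_apply]
    have hab : (a, b) = (a, (0 : X)) + ((0 : Fin n → ℝ), b) := by simp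
    rw [hab, map_add, ← ha, map_sum, hp]
    simp only [map_smul, smul_eq_mul, hl, mul_comm, neg_apply, ContinuousLinearMap.comp_apply,
      ContinuousLinearMap.inr_apply, sub_neg_eq_add]
  have hsep : ∀ (a : Fin n → ℝ) (b : X) (y : Bundle n X), y ∈ closedBall x₀ ε → (∀ i, a i ≤ E.utility i (y i)) →
      E.excess y - b ∈ E.netDemand →
      ∑ i, l i * a i - p b ≤ ∑ i, l i * E.utility i (x i) := fun a b y hy ha hb => by
    have := hfG (a, b) ⟨y, hy, ha, hb⟩
    rwa [hfp, hfp, map_zero, sub_zero] at this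
  have hle : ∀ θ ∈ E.netDemand, p θ ≤ p (E.excess x) := fun θ hθ => by
    have := hsep (E.utilities x) (E.excess x - θ) x hxR.2 (fun _ => le_rfl) (by simpa using hθ)
    simp only [utilities, map_sub] at this
    linarith
  have hp0 : p (E.excess x) = 0 := by
    have h₁ := hle 0 h0
    -- On a cone, comparing the excess with `0` and with its double forces value zero.
    have h₂ := hle _ (hcone _ hxR.1.2 2 (by norm_num))
    rw [map_zero] at h₁
    rw [map_smul, smul_eq_mul] at h₂
    linarith
  refine ⟨l, p, ?_, fun i => ?_, fun s hs => ?_, hp0, fun y hy => ?_⟩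
  · by_contra! hlp
    obtain ⟨g, hg⟩ := hGint
    have := hf g hg
    rw [← Prod.mk.eta (p := g), hfp, hfp, hlp.1, hlp.2] at this
    simp at this
  -- Utility may be discarded, so `l i` cannot be negative.
  · have := hsep (E.utilities x - Pi.single i 1) 0 x hxR.2
      (fun j => sub_le_self _ (by by_cases hj : j = i <;> simp [hj]))
      (by simpa using hxR.1.2)
    simp only [Pi.sub_apply, mul_sub, Finset.sum_sub_distrib, utilities, map_zero] at this
    simp [Pi.single_apply] at this
    linarith
  · rw [map_sub]
    exact sub_nonpos.2 (hle s hs)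
  · rw [hp0, sub_zero]
    exact hsep (E.utilities y) (E.excess y) y hy (fun _ => le_rfl) (by simpa using h0)

/-! ### Decentralization by prices -/

theorem sum_update_add {ι X M : Type*} [Fintype ι] [DecidableEq ι] [AddCommGroup M]
    (F : ι → X → M) (x : ι → X) (i : ι) (z : X) :
    ∑ j, F j (Function.update x i z j) = ∑ j, F j (x j) + (F i z - F i (x i)) := by
  rw [← Finset.add_sum_erase _ _ (Finset.mem_univ i),
    ← Finset.add_sum_erase _ (fun j => F j (x j)) (Finset.mem_univ i), Function.update_self,
    Finset.sum_congr rfl fun j hj => by rw [Function.update_of_ne (Finset.ne_of_mem_erase hj)]]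
  abel

/-- The squared norm sums over components, so a component may move freely as long as it gets no
farther from its centre; hence the individual radii. -/
theorem toLp_update_mem_closedBall {x₀ x : Bundle n X} {ε : ℝ} (hx : x ∈ closedBall x₀ ε)
    {i : Fin n} {z : X} (hz : z ∈ closedBall (x₀ i) ‖x i - x₀ i‖) :
    (WithLp.toLp 2 (Function.update x.ofLp i z) : Bundle n X) ∈ closedBall x₀ ε := by
  rw [mem_closedBall_iff_norm] at hx hz ⊢
  refine le_trans (pow_le_pow_iff_left₀ (norm_nonneg _) (norm_nonneg _) two_ne_zero |>.1 ?_) hx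
  rw [PiLp.norm_sq_eq_of_L2, PiLp.norm_sq_eq_of_L2]
  refine Finset.sum_le_sum fun j _ => ?_
  rcases eq_or_ne j i with rfl | hj
  · simpa using pow_le_pow_left₀ (norm_nonneg _) hz 2
  · simp [Function.update_of_ne hj]

/-- A nonzero functional attains its minimum over a ball of a strictly convex space at most
once. -/
theorem eq_of_isMinOn_closedBall [StrictConvexSpace ℝ X] {p : X →L[ℝ] ℝ} (hp : p ≠ 0) {c x z : X}
    {r : ℝ} (hx : x ∈ closedBall c r) (hmin : IsMinOn p (closedBall c r) x)
    (hz : z ∈ closedBall c r) (hzx : p z ≤ p x) : z = x := by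
  by_contra hne
  have hw := strictConvex_closedBall ℝ c r hz hx hne (by norm_num : (0 : ℝ) < 1 / 2)
    (by norm_num : (0 : ℝ) < 1 / 2) (by norm_num)
  refine hp ((IsLocalMin.hasFDerivAt_eq_zero (f := p) ?_) (p.hasFDerivAt
    (x := (1 / 2 : ℝ) • z + (1 / 2 : ℝ) • x)))
  filter_upwards [mem_interior_iff_mem_nhds.1 hw] with w hw'
  have : p x ≤ p w := hmin hw'
  simp only [map_add, map_smul, smul_eq_mul]
  linarith

/-- Pareto optimal allocations of the localized problem, at which the consumers are locally
non-satiated in their balls, are equilibria of the localized economy. -/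
theorem IsImprovableOn.isEquilibrium_localize [StrictConvexSpace ℝ X] [NeZero n]
    {E : ExchangeEconomy n X} {x₀ v x : Bundle n X} {ε : ℝ} (h : E.IsImprovableOn x₀ v ε)
    (hε : 0 < ε) (hΘ : E.NetDemandCone) (hx : E.IsLocalizedPareto x₀ ε x)
    (hns : (E.localize x₀ fun i => ‖x i - x₀ i‖).LocallyNonSatiatedAt x) :
    (E.localize x₀ fun i => ‖x i - x₀ i‖).IsEquilibrium x := by
  obtain ⟨l, p, hlp, hl, hpN, hp0, hmax⟩ := h.exists_multipliers hε hΘ hx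
  obtain ⟨hxR, -⟩ := id hx
  have hself : ∀ i, x i ∈ closedBall (x₀ i) ‖x i - x₀ i‖ := fun i =>
    mem_closedBall_iff_norm.2 le_rfl
  have hcons : ∀ i, ∀ z ∈ closedBall (x₀ i) ‖x i - x₀ i‖,
      l i * E.utility i z - p z ≤ l i * E.utility i (x i) - p (x i) := fun i z hz => by
    have h₁ := hmax _ (toLp_update_mem_closedBall hxR.2 hz)
    have h₂ := sum_update_add (fun j w => l j * E.utility j w) x.ofLp i z
    have h₃ := sum_update_add (fun _ w => w) x.ofLp i z
    simp only [excess, map_sub, h₂, h₃, map_add] at h₁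
    linarith
  -- If `p = 0`, some `l i > 0`, and its consumer would be satiated in the ball.
  have hp : p ≠ 0 := by
    rintro rfl
    obtain ⟨i, hi⟩ := Function.ne_iff.1 (hlp.resolve_right (by simp))
    obtain ⟨z, hz, hzu⟩ := hns i 1 one_pos
    have hzu' := mul_lt_mul_of_pos_left hzu ((hl i).lt_of_ne' hi)
    have := hcons i z hz.2
    simp only [zero_apply, sub_zero] at this
    exact absurd hzu' this.not_gt
  have hbudget : p (∑ i, x i) = p E.endowment := by
    rw [excess, map_sub] at hp0
    linarith
  -- The allocation itself serves as the endowment distribution.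
  refine ⟨⟨hself, hxR.1.2⟩, p, hp, hpN, hbudget, x.ofLp, hbudget, fun i => ⟨rfl, ?_⟩⟩
  rintro z ⟨hz, hzp⟩
  change E.utility i z ≤ E.utility i (x i)
  rcases (hl i).eq_or_lt with hi | hi
  · refine (congrArg (E.utility i)
      (eq_of_isMinOn_closedBall hp (hself i) (fun w hw => ?_) hz hzp)).le
    have := hcons i w hw
    rw [← hi] at this
    change p (x i) ≤ p w
    linarith
  · have := hcons i z hz
    exact le_of_mul_le_mul_left (by linarith) hi

end ExchangeEconomy

theorem theorem4p2 {X : Type*} [NormedAddCommGroup X] [NormedSpace ℝ X] [CompleteSpace X]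
    (n : ℕ) (hn : 1 ≤ n) (E : ExchangeEconomy n X)
    (hA1 : ExchangeEconomy.CommodityGeometry n X)
    (hA2 : E.ConsumptionInterior)
    (hA3 : E.SmoothUtilities)
    (hA4 : E.NetDemandCone)
    (x₀ : Bundle n X) (hx₀ : E.IsRegular x₀) :
    ∃ ε₀ : ℝ, 0 < ε₀ ∧ (∀ i, Metric.closedBall (x₀ i) ε₀ ⊆ E.consumption i) ∧
      ∀ ε : ℝ, 0 < ε → ε ≤ ε₀ →
        (∃ x ∈ E.feasible ∩ frontier (Metric.closedBall x₀ ε), E.IsLocalizedPareto x₀ ε x) ∧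
        ∀ x ∈ E.feasible ∩ frontier (Metric.closedBall x₀ ε), E.IsLocalizedPareto x₀ ε x →
          E.LocalQualification →
          (E.localize x₀ (fun i => ‖x i - x₀ i‖)).LocallyNonSatiatedAt x →
          (∀ i, 0 < ‖x i - x₀ i‖) →
          (E.localize x₀ (fun i => ‖x i - x₀ i‖)).IsEquilibrium x := by
  have : NeZero n := ⟨by omega⟩
  have : UniformConvexSpace X := hA1.1.1
  obtain ⟨v, ε₀, hε₀, himp⟩ := hx₀.exists_isImprovableOn hA1.2.2 hA3
  refine ⟨ε₀, hε₀, (himp ε₀ hε₀ le_rfl).subset, fun ε hε hle => ⟨?_, ?_⟩⟩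
  · rw [frontier_closedBall _ hε.ne']
    exact (himp ε hε hle).exists_isLocalizedPareto hε hx₀.1 hA4.2.1 hA4.2.2.1
  · intro x _ hx _ hns _
    exact (himp ε hε hle).isEquilibrium_localize hε hA4 hx hns
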